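/- Let $U_\varphi=|0\rangle\langle 0|+e^{i\varphi}|1\rangle\langle 1|$ ($\varphi\in\mathbb R$) be the qubit phase gate, and put $|\varphi\rangle=(|0\rangle+e^{i\varphi}|1\rangle)/\sqrt2$. An $N\to1$ probabilistic storage and retrieval (PSR) protocol for phase gates consists of - a storing network: starting from a fixed state, arbitrary fixed quantum channels on finite-dimensional systems are applied, interleaved with exactly $N$ uses of $U_\varphi$, each acting on one qubit next to an arbitrary memory; the output is a program state $\rho_\varphi$ of some finite-dimensional system $M$; - a retrieving instrument $\{\mathcal R_s,\mathcal R_f\}$, independent of $\varphi$, from a qubit together with $M$ to a qubit (completely positive maps with $\mathcal R_s+\mathcal R_f$ trace preserving), such that $\mathcal R_s(\xi\otimes\rho_\varphi)=\lambda\,U_\varphi\,\xi\,U_\varphi^\dagger$ for all $\varphi$ and all qubit states $\xi$. The constant $\lambda$ is its success probability. A family of program states is called optimal for $N$ uses if it is the output of a storing network with $N$ uses and if some retrieving instrument achieves with it the largest success probability of all $N\to1$ PSR protocols. Let $k\ge0$, $N=2^k-1$, and let $|\Psi^{(k)}_\varphi\rangle=|\varphi\rangle\otimes|2\varphi\rangle\otimes\cdots\otimes|2^{k-1}\varphi\rangle$.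 1. Applying $U_\varphi$ successively $2^{m}$ times to the $m$-th qubit ($m=0,\dots,k-1$) of $|+\rangle^{\otimes k}$, which takes $1+2+\cdots+2^{k-1}=2^k-1$ uses in total, produces $|\Psi^{(k)}_\varphi\rangle$. So $|\Psi^{(k)}_\varphi\rangle$ is the output of a storing network with $2^k-1$ uses of $U_\varphi$. 2. Consider the iterative Vidal–Masanes–Cirac circuit: for $m=0,1,\dots,k-1$, apply a CNOT with the data qubit as control and the $m$-th program qubit as target, and measure that program qubit in the computational basis; on outcome $0$ stop and announce success, on outcome $1$ go on to the next program qubit; announce failure if no program qubit is left. The remaining program qubits are discarded. This circuit contains $k$ CNOT gates and $k$ one-qubit measurements. It is a retrieving instrument, and with the program state $|\Psi^{(k)}_\varphi\rangle$ its success operation maps every qubit state $\xi$ to $(1-2^{-k})\,U_\varphi\,\xi\,U_\varphi^\dagger$ for every $\varphi$. 3. The maximal success probability of a $(2^k-1)\to1$ PSR protocol for phase gates is $1-2^{-k}$. Hence the scheme is optimal, and the program state $|\Psi^{(k)}_\varphi\rangle$ is optimal among all program states that can be prepared with $2^k-1$ uses of $U_\varphi$. Moreover, $1-2^{-k}$ is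 the largest success probability with which any retrieving instrument can retrieve $U_\varphi$ perfectly from $|\Psi^{(k)}_\varphi\rangle$. -/

import Mathlib

open Matrix
open scoped Kronecker BigOperators ComplexOrder

noncomputable section

namespace PhaseStorage

/-! ### States, channels and instruments on finite-dimensional systems

A system with orthonormal basis labelled by a finite type `a` has operators `Matrix a a ℂ`.
A qubit is `Fin 2`, and a register of `n` qubits is `Fin n → Fin 2`. -/

/-- Density operators. -/
def IsState {a : Type} [Fintype a] (ρ : Matrix a a ℂ) : Prop :=
  ρ.PosSemidef ∧ ρ.trace = 1

/-- Completely positive maps, in operator-sum form `X ↦ ∑ᵢ Kᵢ X Kᵢ†`. -/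
def IsCP {a b : Type} [Fintype a] (Φ : Matrix a a ℂ → Matrix b b ℂ) : Prop :=
  ∃ (r : ℕ) (K : Fin r → Matrix b a ℂ), ∀ X, Φ X = ∑ i, K i * X * (K i)ᴴ

/-- Quantum channels: completely positive and trace preserving maps. -/
def IsChannel {a b : Type} [Fintype a] [Fintype b] (Φ : Matrix a a ℂ → Matrix b b ℂ) : Prop :=
  IsCP Φ ∧ ∀ X, (Φ X).trace = X.trace

/-- Two-outcome quantum instruments: a "success" and a "failure" operation, both completely
positive, which add up to a trace preserving map. -/
def IsInstrument {a b : Type} [Fintype a] [Fintype b]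
    (Rs Rf : Matrix a a ℂ → Matrix b b ℂ) : Prop :=
  IsCP Rs ∧ IsCP Rf ∧ ∀ X, (Rs X + Rf X).trace = X.trace

/-- The pure state `|ψ⟩⟨ψ|`. -/
def ketbra {a : Type} (ψ : a → ℂ) : Matrix a a ℂ :=
  vecMulVec ψ (star ψ)

/-! ### Probabilistic storage and retrieval of phase gates -/

/-- The phase gate `U_φ = |0⟩⟨0| + e^{iφ} |1⟩⟨1|`. -/
def U (φ : ℝ) : Matrix (Fin 2) (Fin 2) ℂ :=
  diagonal ![1, Complex.exp (φ * Complex.I)]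

/-- `StoredWith N M ρ`: the family of states `ρ φ` of the system `M` is the output of a storing
network with exactly `N` open slots into each of which the gate `U_φ` is inserted. A network starts
from a fixed state; every use of `U_φ` acts on a qubit, next to an arbitrary memory `A` on which
nothing happens; before, between and after the uses, arbitrary fixed channels are applied. -/
inductive StoredWith : ℕ → (M : Type) → (ℝ → Matrix M M ℂ) → Prop
  | prepare {M : Type} [Fintype M] (ρ : Matrix M M ℂ) (hρ : IsState ρ) :
      StoredWith 0 M (fun _ => ρ)
  | use {N : ℕ} {A : Type} [Fintype A] [DecidableEq A] {ρ : ℝ → Matrix (Fin 2 × A) (Fin 2 × A) ℂ}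
      (h : StoredWith N (Fin 2 × A) ρ) :
      StoredWith (N + 1) (Fin 2 × A)
        (fun φ => (U φ ⊗ₖ (1 : Matrix A A ℂ)) * ρ φ * (U φ ⊗ₖ (1 : Matrix A A ℂ))ᴴ)
  | process {N : ℕ} {M M' : Type} [Fintype M] [Fintype M'] {ρ : ℝ → Matrix M M ℂ}
      (E : Matrix M M ℂ → Matrix M' M' ℂ) (hE : IsChannel E) (h : StoredWith N M ρ) :
      StoredWith N M' (fun φ => E (ρ φ))

/-- The operation `Rs`, acting on the input qubit and on the program register, implements `U_φ`
without error and with the same probability `p` for all `φ` and all inputs `ξ`, when the program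
register is in the state `ρ φ`. -/
def RetrievesPerfectly {M : Type} (Rs : Matrix (Fin 2 × M) (Fin 2 × M) ℂ → Matrix (Fin 2) (Fin 2) ℂ)
    (ρ : ℝ → Matrix M M ℂ) (p : ℝ) : Prop :=
  ∀ (φ : ℝ) (ξ : Matrix (Fin 2) (Fin 2) ℂ), IsState ξ →
    Rs (ξ ⊗ₖ ρ φ) = (p : ℂ) • (U φ * ξ * (U φ)ᴴ)

/-- The success probabilities of perfect retrieval of `U_φ` that can be reached, by some retrieving
instrument, from the program states `ρ φ`. -/
def retrievalProbs {M : Type} [Fintype M] (ρ : ℝ → Matrix M M ℂ) : Set ℝ :=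
  {p | ∃ Rs Rf : Matrix (Fin 2 × M) (Fin 2 × M) ℂ → Matrix (Fin 2) (Fin 2) ℂ,
    IsInstrument Rs Rf ∧ RetrievesPerfectly Rs ρ p}

/-- The success probabilities of all `N → 1` probabilistic storage and retrieval protocols. -/
def psrProbs (N : ℕ) : Set ℝ :=
  {p | ∃ (M : Type) (_ : Fintype M) (ρ : ℝ → Matrix M M ℂ),
    StoredWith N M ρ ∧ p ∈ retrievalProbs ρ}

/-- The program states `ρ φ` are optimal among all program states that can be prepared with `N` uses
of `U_φ`: they can be prepared so, and some retrieval from them has the largest success probability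
of all `N → 1` protocols. -/
def IsOptimalProgram (N : ℕ) {M : Type} [Fintype M] (ρ : ℝ → Matrix M M ℂ) : Prop :=
  StoredWith N M ρ ∧ ∃ p ∈ retrievalProbs ρ, IsGreatest (psrProbs N) p

/-! ### Gates on a register of qubits -/

/-- The one-qubit operator `A` acting on qubit `q` of a register. -/
def onQubit {n : ℕ} (q : Fin n) (A : Matrix (Fin 2) (Fin 2) ℂ) :
    Matrix (Fin n → Fin 2) (Fin n → Fin 2) ℂ :=
  Matrix.of fun x y => if ∀ r, r ≠ q → x r = y r then A (x q) (y q) else 0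

/-- The CNOT gate with control `c` and target `t`: `|j⟩|l⟩ ↦ |j⟩|j ⊕ l⟩`
(addition in `Fin 2` is addition modulo 2). -/
def cnotGate {n : ℕ} (c t : Fin n) : Matrix (Fin n → Fin 2) (Fin n → Fin 2) ℂ :=
  Matrix.of fun x y => if x = Function.update y t (y c + y t) then 1 else 0

/-- The projector on the computational basis state `b` of qubit `q`. -/
def proj {n : ℕ} (q : Fin n) (b : Fin 2) : Matrix (Fin n → Fin 2) (Fin n → Fin 2) ℂ :=
  onQubit q (Matrix.single b b 1)

/-- Adaptive circuits on `n` qubits made of CNOT gates and one-qubit measurements in the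
computational basis. After a measurement the circuit continues with the first branch on outcome 0
and with the second one on outcome 1. It ends by announcing success (`true`) or failure (`false`). -/
inductive Circuit (n : ℕ) : Type
  | finish (success : Bool) : Circuit n
  | cnot (c t : Fin n) (hct : c ≠ t) (rest : Circuit n) : Circuit n
  | measure (q : Fin n) (onZero onOne : Circuit n) : Circuit n

namespace Circuit

variable {n : ℕ}

/-- The number of CNOT gates of a circuit, over all its branches. -/
def cnotCount : Circuit n → ℕ
  | finish _ => 0
  | cnot _ _ _ C => C.cnotCount + 1
  | measure _ C₀ C₁ => C₀.cnotCount + C₁.cnotCount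

/-- The number of one-qubit measurements of a circuit, over all its branches. -/
def measurementCount : Circuit n → ℕ
  | finish _ => 0
  | cnot _ _ _ C => C.measurementCount
  | measure _ C₀ C₁ => C₀.measurementCount + C₁.measurementCount + 1

/-- The unnormalized final state of the register on the event that the circuit announces `s`. -/
def run (s : Bool) : Circuit n → Matrix (Fin n → Fin 2) (Fin n → Fin 2) ℂ →
    Matrix (Fin n → Fin 2) (Fin n → Fin 2) ℂ
  | finish s', X => if s' = s then X else 0
  | cnot c t _ C, X => C.run s (cnotGate c t * X * (cnotGate c t)ᴴ)
  | measure q C₀ C₁, X =>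
      C₀.run s (proj q 0 * X * (proj q 0)ᴴ) + C₁.run s (proj q 1 * X * (proj q 1)ᴴ)

/-- The operation of a circuit on the event that it announces `s`, when qubit `0` holds the data
and the other `k` qubits hold the program: run the circuit, then discard the program qubits. -/
def operation {k : ℕ} (C : Circuit (k + 1)) (s : Bool)
    (X : Matrix (Fin 2 × (Fin k → Fin 2)) (Fin 2 × (Fin k → Fin 2)) ℂ) :
    Matrix (Fin 2) (Fin 2) ℂ :=
  Matrix.of fun i j => ∑ z : Fin k → Fin 2,
    C.run s (Matrix.of fun x y => X (x 0, Fin.tail x) (y 0, Fin.tail y))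
      (Fin.cons i z) (Fin.cons j z)

end Circuit

/-! ### The scheme of Vidal, Masanes and Cirac -/

/-- The qubit state `|φ⟩ = (|0⟩ + e^{iφ} |1⟩) / √2`. -/
def phaseKet (φ : ℝ) : Fin 2 → ℂ :=
  fun b => ((Real.sqrt 2 : ℝ) : ℂ)⁻¹ * ![1, Complex.exp (φ * Complex.I)] b

/-- The product state `|+⟩ ⊗ ⋯ ⊗ |+⟩` of `k` qubits. -/
def plusState (k : ℕ) : (Fin k → Fin 2) → ℂ :=
  fun x => ∏ m, ((Real.sqrt 2 : ℝ) : ℂ)⁻¹ * ![1, 1] (x m)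

/-- The program state `|φ⟩ ⊗ |2φ⟩ ⊗ ⋯ ⊗ |2^(k-1) φ⟩`. -/
def vmcProgram (k : ℕ) (φ : ℝ) : (Fin k → Fin 2) → ℂ :=
  fun x => ∏ m : Fin k, phaseKet (2 ^ (m : ℕ) * φ) (x m)

/-- Apply `U_φ` successively to the listed qubits: one use of the gate for each entry. -/
def applyUses {k : ℕ} (φ : ℝ) (l : List (Fin k)) (ψ : (Fin k → Fin 2) → ℂ) :
    (Fin k → Fin 2) → ℂ :=
  l.foldl (fun v q => onQubit q (U φ) *ᵥ v) ψ

/-- Qubit number `m` (counted from 0) undergoes `2^m` uses of the gate. -/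
def vmcUses (k : ℕ) : List (Fin k) :=
  (List.finRange k).flatMap fun m : Fin k => List.replicate (2 ^ (m : ℕ)) m

/-- The iterated programmable phase gate, with the listed program qubits still at its disposal:
CNOT from the data qubit to the next program qubit, which is then measured; outcome 0 is success,
and after outcome 1 the next program qubit is tried. -/
def vmcSteps {k : ℕ} : List (Fin k) → Circuit (k + 1)
  | [] => Circuit.finish false
  | m :: l => Circuit.cnot 0 m.succ (Fin.succ_ne_zero m).symm
      (Circuit.measure m.succ (Circuit.finish true) (vmcSteps l))

/-- The retrieving circuit of the scheme, which uses the `k` program qubits in their order. -/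
def vmcRetrieval (k : ℕ) : Circuit (k + 1) :=
  vmcSteps (List.finRange k)

end PhaseStorage

end

open PhaseStorage

namespace PhaseStorage

/-! ### Completely positive maps -/

/-! Achievability. A CNOT onto a program qubit in the state `|θ⟩`, followed by a measurement,
applies `U_θ` or, up to a global phase, `U_{-θ}` to the data, each with probability 1/2. After
failures with angles `φ, 2φ, …, 2^(m-1) φ` the rotation still owed is by `2^m φ`, which is what the
next program qubit stores. The success probabilities 1/2, 1/4, … add up to `1 - 2^(-k)`
(`successFactor_vmc`).

Optimality. Put `z = e^{iφ}`. After `N` uses the program is a sum of pure terms whose vectors are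
polynomials `∑_{n ≤ N} z^n a_n` (`StoredWith.exists_expansion`). Let `q n` be the total squared norm
of the coefficients at `z^n`; Parseval gives `∑ q n = 1`. Perfect retrieval forces every Kraus
amplitude `1 → 1` to be `z` times the amplitude `0 → 0` (`amplitudes_of_perfect`). Comparing
coefficients, the weight `s n` of the `0 → 0` amplitude at `z^n` equals the weight of the `1 → 1`
amplitude at `z^(n+1)`, and `s N = 0` (`coeff_shift`). As instruments do not increase norms, `s n ≤
q n` and `s n ≤ q (n+1)`. Parseval also gives `p = ∑ s n`, and a weighted sum of these inequalities
yields `p ≤ N/(N+1)` (`sum_le_of_le_neighbours`), which is `1 - 2^(-k)` at `N = 2^k - 1`. -/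

theorem isCP_of_fintype {a b ι : Type} [Fintype a] [Fintype ι] {Φ : Matrix a a ℂ → Matrix b b ℂ}
    (K : ι → Matrix b a ℂ) (h : ∀ X, Φ X = ∑ i, K i * X * (K i)ᴴ) : IsCP Φ := by
  refine ⟨Fintype.card ι, fun i => K ((Fintype.equivFin ι).symm i), fun X => ?_⟩
  rw [h]
  exact ((Fintype.equivFin ι).symm.sum_comp (fun i => K i * X * (K i)ᴴ)).symm

theorem isCP_conj {a b : Type} [Fintype a] (K : Matrix b a ℂ) :
    IsCP (fun X : Matrix a a ℂ => K * X * Kᴴ) :=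
  isCP_of_fintype (ι := Unit) (fun _ => K) (by simp)

theorem isCP_zero {a b : Type} [Fintype a] :
    IsCP (fun _ : Matrix a a ℂ => (0 : Matrix b b ℂ)) :=
  isCP_of_fintype (ι := Empty) (fun _ => 0) (by simp)

theorem isCP_id {a : Type} [Fintype a] [DecidableEq a] : IsCP (fun X : Matrix a a ℂ => X) :=
  isCP_of_fintype (ι := Unit) (fun _ => 1) (by simp)

theorem IsCP.add {a b : Type} [Fintype a] {Φ Ψ : Matrix a a ℂ → Matrix b b ℂ}
    (hΦ : IsCP Φ) (hΨ : IsCP Ψ) : IsCP (fun X => Φ X + Ψ X) := by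
  obtain ⟨r, K, hK⟩ := hΦ
  obtain ⟨s, L, hL⟩ := hΨ
  refine isCP_of_fintype (ι := Fin r ⊕ Fin s) (Sum.elim K L) fun X => ?_
  simp [hK, hL]

theorem IsCP.comp {a b c : Type} [Fintype a] [Fintype b] {Ψ : Matrix b b ℂ → Matrix c c ℂ}
    {Φ : Matrix a a ℂ → Matrix b b ℂ} (hΨ : IsCP Ψ) (hΦ : IsCP Φ) : IsCP (fun X => Ψ (Φ X)) := by
  obtain ⟨r, K, hK⟩ := hΦ
  obtain ⟨s, L, hL⟩ := hΨ
  refine isCP_of_fintype (ι := Fin s × Fin r) (fun i => L i.1 * K i.2) fun X => ?_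
  simp [hK, hL, Fintype.sum_prod_type, Matrix.mul_sum, Matrix.sum_mul, Matrix.mul_assoc,
    Matrix.conjTranspose_mul]

/-- The rows `e i` of the identity form a single Kraus operator. Here `e` is arbitrary; only trace
preservation would need a bijection. -/
theorem isCP_submatrix {a b : Type} [Fintype a] [DecidableEq a] (e : b → a) :
    IsCP (fun X : Matrix a a ℂ => X.submatrix e e) := by
  convert isCP_conj ((1 : Matrix a a ℂ).submatrix e id) using 2 with X
  ext i j
  simp [Matrix.mul_apply, Matrix.one_apply]

theorem isCP_partialTrace {b c : Type} [Fintype b] [Fintype c] [DecidableEq b] [DecidableEq c]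
    {a : Type} [Fintype a] [DecidableEq a] (e : b → c → a) :
    IsCP (fun X : Matrix a a ℂ => (Matrix.of fun i j => ∑ z, X (e i z) (e j z) :
      Matrix b b ℂ)) := by
  refine isCP_of_fintype (ι := c) (fun z => (1 : Matrix a a ℂ).submatrix (fun i => e i z) id)
    fun X => ?_
  ext i j
  simp [Matrix.mul_apply, Matrix.one_apply, Matrix.sum_apply]

/-! ### Circuits of CNOT gates and measurements -/

theorem proj_conj_apply {n : ℕ} (q : Fin n) (b : Fin 2) (X : Matrix (Fin n → Fin 2) (Fin n → Fin 2) ℂ)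
    (x y : Fin n → Fin 2) :
    (proj q b * X * (proj q b)ᴴ) x y = if x q = b ∧ y q = b then X x y else 0 := by
  have h : proj q b = diagonal fun x => if x q = b then (1 : ℂ) else 0 := by
    ext x y
    simp only [proj, onQubit, Matrix.of_apply, Matrix.diagonal_apply, Matrix.single_apply]
    by_cases hxy : x = y
    · subst hxy
      simp [eq_comm]
    · rw [if_neg hxy]
      split_ifs with h1 h2
      · exfalso
        apply hxy
        ext r
        by_cases hr : r = q
        · subst hr
          rw [← h2.1, ← h2.2]
        · rw [h1 r hr]
      · rfl
      · rfl
  rw [h, Matrix.diagonal_conjTranspose, Matrix.mul_diagonal, Matrix.diagonal_mul]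
  by_cases hx : x q = b <;> by_cases hy : y q = b <;> simp [hx, hy]

/-- The action of the CNOT gate on the computational basis. -/
def cnotMap {n : ℕ} (c t : Fin n) (x : Fin n → Fin 2) : Fin n → Fin 2 :=
  Function.update x t (x c + x t)

theorem cnotMap_involutive {n : ℕ} {c t : Fin n} (hct : c ≠ t) :
    Function.Involutive (cnotMap c t) := by
  intro x
  ext r
  by_cases hr : r = t
  · subst hr
    simp only [cnotMap, Function.update_self, Function.update_of_ne hct]
    generalize x c = u
    generalize x r = v
    fin_cases u <;> fin_cases v <;> rfl
  · simp [cnotMap, hr]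

theorem cnot_conj_apply {n : ℕ} {c t : Fin n} (hct : c ≠ t)
    (X : Matrix (Fin n → Fin 2) (Fin n → Fin 2) ℂ) (x y : Fin n → Fin 2) :
    (cnotGate c t * X * (cnotGate c t)ᴴ) x y = X (cnotMap c t x) (cnotMap c t y) := by
  have h : cnotGate c t = (1 : Matrix (Fin n → Fin 2) (Fin n → Fin 2) ℂ).submatrix
      (cnotMap c t) id := by
    ext x y
    simp only [cnotGate, Matrix.of_apply, Matrix.submatrix_apply, Matrix.one_apply, id]
    refine if_congr ?_ rfl rfl
    change x = cnotMap c t y ↔ _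
    constructor
    · rintro rfl
      exact cnotMap_involutive hct y
    · rintro rfl
      exact (cnotMap_involutive hct x).symm
  rw [h]
  simp [Matrix.mul_apply, Matrix.one_apply]

namespace Circuit

theorem isCP_run {n : ℕ} (s : Bool) (C : Circuit n) : IsCP (C.run s) := by
  induction C with
  | finish s' =>
    by_cases h : s' = s
    · have : (finish s' : Circuit n).run s = fun X => X := by funext X; simp [run, h]
      rw [this]
      exact isCP_id
    · have : (finish s' : Circuit n).run s = fun X => 0 := by funext X; simp [run, h]
      rw [this]
      exact isCP_zero
  | cnot c t hct C ih => exact ih.comp (isCP_conj (cnotGate c t))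
  | measure q C₀ C₁ ih₀ ih₁ =>
    exact (ih₀.comp (isCP_conj (proj q 0))).add (ih₁.comp (isCP_conj (proj q 1)))

theorem trace_run {n : ℕ} (C : Circuit n) (X : Matrix (Fin n → Fin 2) (Fin n → Fin 2) ℂ) :
    (C.run true X).trace + (C.run false X).trace = X.trace := by
  induction C generalizing X with
  | finish s' => cases s' <;> simp [run]
  | cnot c t hct C ih =>
    simp only [run]
    rw [ih]
    simp only [Matrix.trace, Matrix.diag_apply, cnot_conj_apply hct]
    exact Equiv.sum_comp (cnotMap_involutive hct).toPerm (fun x => X x x)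
  | measure q C₀ C₁ ih₀ ih₁ =>
    simp only [run, Matrix.trace_add]
    rw [add_add_add_comm, ih₀, ih₁]
    simp only [Matrix.trace, Matrix.diag_apply, proj_conj_apply, and_self]
    rw [← Finset.sum_add_distrib]
    refine Finset.sum_congr rfl fun x _ => ?_
    generalize x q = u
    fin_cases u <;> simp

theorem isCP_operation {k : ℕ} (C : Circuit (k + 1)) (s : Bool) : IsCP (C.operation s) :=
  (isCP_partialTrace (fun (i : Fin 2) (z : Fin k → Fin 2) =>
    (Fin.cons i z : Fin (k + 1) → Fin 2))).comp
    ((isCP_run s C).comp (isCP_submatrix (fun x : Fin (k + 1) → Fin 2 => (x 0, Fin.tail x))))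

theorem isInstrument_operation {k : ℕ} (C : Circuit (k + 1)) :
    IsInstrument (C.operation true) (C.operation false) := by
  refine ⟨isCP_operation C true, isCP_operation C false, fun X => ?_⟩
  have h : ∀ s, (C.operation s X).trace = (C.run s (Matrix.of fun x y =>
      X (x 0, Fin.tail x) (y 0, Fin.tail y))).trace := by
    intro s
    simp only [operation, Matrix.trace, Matrix.diag_apply, Matrix.of_apply]
    rw [← (Fin.consEquiv fun _ : Fin (k + 1) => Fin 2).sum_comp, Fintype.sum_prod_type]
    rfl
  rw [Matrix.trace_add, h, h, trace_run]
  simp only [Matrix.trace, Matrix.diag_apply, Matrix.of_apply]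
  rw [← (Fin.consEquiv fun _ : Fin (k + 1) => Fin 2).sum_comp]
  rfl

end Circuit

/-! ### The retrieving circuit -/

theorem cnotCount_vmcSteps {k : ℕ} (l : List (Fin k)) : (vmcSteps l).cnotCount = l.length := by
  induction l with
  | nil => rfl
  | cons m l ih => simp [vmcSteps, Circuit.cnotCount, ih]

theorem measurementCount_vmcSteps {k : ℕ} (l : List (Fin k)) :
    (vmcSteps l).measurementCount = l.length := by
  induction l with
  | nil => rfl
  | cons m l ih => simp [vmcSteps, Circuit.measurementCount, ih]

/-- The register state with data operator `ξ` and a product `⨂ g m` on the program qubits. -/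
def productRegister {k : ℕ} (ξ : Matrix (Fin 2) (Fin 2) ℂ) (g : Fin k → Matrix (Fin 2) (Fin 2) ℂ) :
    Matrix (Fin (k + 1) → Fin 2) (Fin (k + 1) → Fin 2) ℂ :=
  Matrix.of fun x y => ξ (x 0) (y 0) * ∏ m, g m (x m.succ) (y m.succ)

/-- The coefficients by which the success operation of `vmcSteps l` multiplies the entries of the
data operator, when the program qubits are in the product state `⨂ g m`. -/
def successFactor {k : ℕ} (g : Fin k → Matrix (Fin 2) (Fin 2) ℂ) (i j : Fin 2) :
    List (Fin k) → ℂ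
  | [] => 0
  | m :: l => g m i j + g m (1 + i) (1 + j) * successFactor g i j l

theorem successFactor_congr {k : ℕ} {g g' : Fin k → Matrix (Fin 2) (Fin 2) ℂ} (i j : Fin 2)
    (l : List (Fin k)) (h : ∀ m ∈ l, g m = g' m) :
    successFactor g i j l = successFactor g' i j l := by
  induction l with
  | nil => rfl
  | cons m l ih =>
    rw [successFactor, successFactor, h m (by simp), ih fun m hm => h m (by simp [hm])]

/-- If the data row is `i` and the outcome is `b`, the program qubit was in row `b + i` before the
CNOT. Hence the data entries pick up a factor from `g m`, and the register remains a product, which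
lets the circuit be followed step by step. -/
theorem productRegister_cnot_measure {k : ℕ} (ξ : Matrix (Fin 2) (Fin 2) ℂ)
    (g : Fin k → Matrix (Fin 2) (Fin 2) ℂ) (m : Fin k) (b : Fin 2) :
    proj m.succ b * (cnotGate 0 m.succ * productRegister ξ g * (cnotGate 0 m.succ)ᴴ) *
      (proj m.succ b)ᴴ =
    productRegister (Matrix.of fun i j => ξ i j * g m (b + i) (b + j))
      (Function.update g m (Matrix.single b b 1)) := by
  have h0 : (0 : Fin (k + 1)) ≠ m.succ := (Fin.succ_ne_zero m).symm
  ext x y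
  rw [proj_conj_apply, cnot_conj_apply h0]
  simp only [productRegister, Matrix.of_apply]
  rw [← Finset.mul_prod_erase _ (fun r => g r _ _) (Finset.mem_univ m),
    ← Finset.mul_prod_erase _ (fun r => Function.update g m (Matrix.single b b 1) r _ _)
      (Finset.mem_univ m)]
  have h2 : ∏ r ∈ Finset.univ.erase m, Function.update g m (Matrix.single b b 1) r
      (x r.succ) (y r.succ) = ∏ r ∈ Finset.univ.erase m, g r (x r.succ) (y r.succ) :=
    Finset.prod_congr rfl fun r hr => by rw [Function.update_of_ne (Finset.ne_of_mem_erase hr)]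
  have h3 : ∏ r ∈ Finset.univ.erase m, g r (cnotMap 0 m.succ x r.succ) (cnotMap 0 m.succ y r.succ) =
      ∏ r ∈ Finset.univ.erase m, g r (x r.succ) (y r.succ) :=
    Finset.prod_congr rfl fun r hr => by
      have : r.succ ≠ m.succ := fun h => Finset.ne_of_mem_erase hr (Fin.succ_injective _ h)
      simp [cnotMap, this]
  rw [h2, h3, Function.update_self, Matrix.single_apply]
  simp only [cnotMap, Function.update_self, Function.update_of_ne h0]
  by_cases hx : x m.succ = b <;> by_cases hy : y m.succ = b <;>
    simp [hx, hy, eq_comm (a := b), add_comm, mul_assoc]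

theorem partialTrace_productRegister {k : ℕ} (ξ : Matrix (Fin 2) (Fin 2) ℂ)
    (g : Fin k → Matrix (Fin 2) (Fin 2) ℂ) (hg : ∀ m, (g m).trace = 1) (i j : Fin 2) :
    ∑ z : Fin k → Fin 2, productRegister ξ g (Fin.cons i z) (Fin.cons j z) = ξ i j := by
  simp only [productRegister, Matrix.of_apply, Fin.cons_zero, Fin.cons_succ]
  rw [← Finset.mul_sum, ← Fintype.prod_sum (fun m b => g m b b),
    Finset.prod_eq_one (fun m _ => show ∑ b, g m b b = 1 from hg m), mul_one]

theorem partialTrace_run_vmcSteps {k : ℕ} (l : List (Fin k)) (hl : l.Nodup)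
    (ξ : Matrix (Fin 2) (Fin 2) ℂ) (g : Fin k → Matrix (Fin 2) (Fin 2) ℂ)
    (hg : ∀ m, (g m).trace = 1) (i j : Fin 2) :
    ∑ z : Fin k → Fin 2, (vmcSteps l).run true (productRegister ξ g) (Fin.cons i z)
      (Fin.cons j z) = ξ i j * successFactor g i j l := by
  induction l generalizing ξ g with
  | nil => simp [vmcSteps, Circuit.run, successFactor]
  | cons m l ih =>
    have hg' : ∀ b r, (Function.update g m (Matrix.single b b 1) r).trace = 1 := by
      intro b r
      by_cases hr : r = m
      · subst hr
        simp
      · rw [Function.update_of_ne hr, hg]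
    simp only [vmcSteps, Circuit.run, Matrix.add_apply, Finset.sum_add_distrib, if_true]
    -- Outcome 0 leaves just a partial trace; outcome 1 continues along `l`, where the measured
    -- qubit `m` does not recur, so the updated `g` may be replaced by `g`.
    rw [productRegister_cnot_measure, productRegister_cnot_measure,
      partialTrace_productRegister _ _ (hg' 0), ih (List.nodup_cons.1 hl).2 _ _ (hg' 1),
      successFactor_congr (g' := g) i j l fun r hr => by
        rw [Function.update_of_ne]
        rintro rfl
        exact (List.nodup_cons.1 hl).1 hr]
    simp [successFactor]
    ring

theorem ketbra_phaseKet (φ : ℝ) :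
    ketbra (phaseKet φ) = Matrix.of ![![1 / 2, Complex.exp (-(φ * Complex.I)) / 2],
      ![Complex.exp (φ * Complex.I) / 2, 1 / 2]] := by
  have h2 : (((Real.sqrt 2 : ℝ) : ℂ))⁻¹ * (((Real.sqrt 2 : ℝ) : ℂ))⁻¹ = 1 / 2 := by
    rw [← mul_inv, ← Complex.ofReal_mul, Real.mul_self_sqrt (by norm_num)]
    norm_num
  have hc : (starRingEnd ℂ) (Complex.exp (φ * Complex.I)) = Complex.exp (-(φ * Complex.I)) := by
    rw [← Complex.exp_conj]
    simp
  have hm : Complex.exp (φ * Complex.I) * Complex.exp (-(φ * Complex.I)) = 1 := by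
    rw [← Complex.exp_add]
    simp
  ext i j
  fin_cases i <;> fin_cases j <;>
    simp only [ketbra, vecMulVec_apply, phaseKet, Pi.star_apply, RCLike.star_def, map_mul, map_inv₀,
      Complex.conj_ofReal] <;> simp [hc]
  · rw [h2]
    norm_num
  · linear_combination Complex.exp (-(φ * Complex.I)) * h2
  · linear_combination Complex.exp (φ * Complex.I) * h2
  · linear_combination h2 + ((√2 : ℝ) : ℂ)⁻¹ * ((√2 : ℝ) : ℂ)⁻¹ * hm

theorem trace_ketbra_phaseKet (φ : ℝ) : (ketbra (phaseKet φ)).trace = 1 := by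
  rw [ketbra_phaseKet]
  simp [Matrix.trace_fin_two]
  norm_num

/-- The starting index `m` is free so that the induction can pass to the tail. For `z = exp(i 2^m
φ)` the tail supplies `z²`, failure supplies `z⁻¹/2`, and `z/2 + (z⁻¹/2)(1 - t) z² = (1 - t/2) z`
with `t = 2^(-n)`. -/
theorem successFactor_vmc {k : ℕ} (φ : ℝ) (n : ℕ) (m : ℕ) (l : List (Fin k))
    (hl : l.map Fin.val = List.range' m n) :
    Matrix.of (fun i j => successFactor (fun m => ketbra (phaseKet (2 ^ (m : ℕ) * φ))) i j l) =
      (1 - 1 / 2 ^ n : ℂ) • Matrix.of ![![1, Complex.exp (-((2 ^ m * φ : ℝ) * Complex.I))],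
        ![Complex.exp ((2 ^ m * φ : ℝ) * Complex.I), 1]] := by
  induction n generalizing m l with
  | zero =>
    obtain rfl : l = [] := by simpa using hl
    ext i j
    simp [successFactor]
  | succ n ih =>
    obtain _ | ⟨a, l⟩ := l
    · simp at hl
    · rw [List.range'_succ, List.map_cons, List.cons.injEq] at hl
      obtain ⟨rfl, hl⟩ := hl
      have ih' := ih _ _ hl
      have key : ∀ i j, successFactor (fun m => ketbra (phaseKet (2 ^ (m : ℕ) * φ))) i j l = _ :=
        fun i j => congrFun (congrFun ih' i) j
      have e1 : Complex.exp ((2 ^ (a.val + 1) * φ : ℝ) * Complex.I) =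
          Complex.exp ((2 ^ a.val * φ : ℝ) * Complex.I) ^ 2 := by
        rw [← Complex.exp_nat_mul]
        congr 1
        push_cast
        ring
      have e2 : Complex.exp (-((2 ^ (a.val + 1) * φ : ℝ) * Complex.I)) =
          Complex.exp (-((2 ^ a.val * φ : ℝ) * Complex.I)) ^ 2 := by
        rw [← Complex.exp_nat_mul]
        congr 1
        push_cast
        ring
      have e3 : Complex.exp ((2 ^ a.val * φ : ℝ) * Complex.I) *
          Complex.exp (-((2 ^ a.val * φ : ℝ) * Complex.I)) = 1 := by
        rw [← Complex.exp_add]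
        simp
      have e4 : (1 / 2 ^ (n + 1) : ℂ) = 1 / 2 ^ n / 2 := by rw [pow_succ, div_div]
      ext i j
      rw [Matrix.of_apply, successFactor, key, ketbra_phaseKet, e1, e2, e4]
      generalize Complex.exp ((2 ^ a.val * φ : ℝ) * Complex.I) = z at *
      generalize Complex.exp (-((2 ^ a.val * φ : ℝ) * Complex.I)) = w at *
      generalize (1 / 2 ^ n : ℂ) = t
      fin_cases i <;> fin_cases j <;>
        simp only [Fin.zero_eta, Fin.mk_one, Matrix.smul_apply, Matrix.of_apply, smul_eq_mul,
          show (1 : Fin 2) + 1 = 0 from rfl, show (1 : Fin 2) + 0 = 1 from rfl,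
          Matrix.cons_val_zero, Matrix.cons_val_one]
      · ring
      · linear_combination (1 - t) / 2 * w * e3
      · linear_combination (1 - t) / 2 * z * e3
      · ring

theorem retrievesPerfectly_vmcRetrieval (k : ℕ) :
    RetrievesPerfectly ((vmcRetrieval k).operation true)
      (fun φ => ketbra (vmcProgram k φ)) (1 - 1 / 2 ^ k) := by
  intro φ ξ _
  have hX : (Matrix.of fun x y : Fin (k + 1) → Fin 2 => (ξ ⊗ₖ ketbra (vmcProgram k φ))
      (x 0, Fin.tail x) (y 0, Fin.tail y)) =
      productRegister ξ fun m => ketbra (phaseKet (2 ^ (m : ℕ) * φ)) := by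
    ext x y
    simp [productRegister, ketbra, vecMulVec_apply, vmcProgram, Fin.tail, Finset.prod_mul_distrib]
  have hS := successFactor_vmc (k := k) φ k 0 (List.finRange k) (by
    rw [List.map_coe_finRange_eq_range, List.range_eq_range'])
  ext i j
  rw [Circuit.operation, Matrix.of_apply, hX, vmcRetrieval,
    partialTrace_run_vmcSteps _ (List.nodup_finRange k) _ _ fun m => trace_ketbra_phaseKet _]
  have := congrFun (congrFun hS i) j
  rw [Matrix.of_apply] at this
  rw [this]
  have hc : (starRingEnd ℂ) (Complex.exp (φ * Complex.I)) = Complex.exp (-(φ * Complex.I)) := by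
    rw [← Complex.exp_conj]
    simp
  have hm : Complex.exp (φ * Complex.I) * Complex.exp (-(φ * Complex.I)) = 1 := by
    rw [← Complex.exp_add]
    simp
  rw [U, Matrix.diagonal_conjTranspose, Matrix.smul_apply (_ : ℂ) (_ * _), Matrix.mul_diagonal,
    Matrix.diagonal_mul]
  fin_cases i <;> fin_cases j <;> simp [hc]
  · ring
  · ring
  · ring
  · linear_combination -(1 - (2 ^ k : ℂ)⁻¹) * ξ 1 1 * hm

/-! ### Program states are trigonometric polynomials of degree at most `N` -/

theorem conj_ketbra {a b : Type} [Fintype a] (K : Matrix b a ℂ) (ψ : a → ℂ) :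
    K * ketbra ψ * Kᴴ = ketbra (K *ᵥ ψ) := by
  rw [ketbra, ketbra, Matrix.mul_vecMulVec, Matrix.vecMulVec_mul, Matrix.star_mulVec]

theorem U_mul_apply (φ : ℝ) {A : Type} [Fintype A] [DecidableEq A] (ψ : Fin 2 × A → ℂ)
    (x : Fin 2 × A) : ((U φ ⊗ₖ (1 : Matrix A A ℂ)) *ᵥ ψ) x =
      ![1, Complex.exp (φ * Complex.I)] x.1 * ψ x := by
  rw [U, ← Matrix.diagonal_one, Matrix.diagonal_kronecker_diagonal, Matrix.mulVec_diagonal, mul_one]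

/-- Each use of the gate raises the degree in `e^{iφ}` by at most one, and the Kraus operators of
fixed channels do not depend on `φ`. -/
theorem StoredWith.exists_expansion {N : ℕ} {M : Type} {ρ : ℝ → Matrix M M ℂ}
    (h : StoredWith N M ρ) : ∃ (ι : Type) (_ : Fintype ι) (a : ι → ℕ → M → ℂ), ∀ φ,
      ρ φ = ∑ i, ketbra (∑ n ∈ Finset.range (N + 1), Complex.exp (φ * Complex.I) ^ n • a i n) := by
  induction h with
  | prepare ρ hρ =>
    obtain ⟨m, a, ha⟩ := Matrix.posSemidef_iff_eq_sum_vecMulVec.1 hρ.1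
    exact ⟨Fin m, inferInstance, fun i _ => a i, fun φ => by simpa [ketbra] using ha⟩
  | @use N A _ _ ρ h ih =>
    obtain ⟨ι, _, a, ha⟩ := ih
    -- On `|0⟩` the coefficients are kept and padded by zero at `N + 1`; on `|1⟩` they move up one
    -- degree, leaving zero in degree 0.
    refine ⟨ι, inferInstance, fun i n x =>
      ![if n ≤ N then a i n x else 0, if n = 0 then 0 else a i (n - 1) x] x.1, fun φ => ?_⟩
    simp only [ha, Matrix.mul_sum, Matrix.sum_mul, conj_ketbra]
    refine Finset.sum_congr rfl fun i _ => congrArg ketbra ?_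
    ext ⟨x, m⟩
    rw [U_mul_apply]
    simp only [Finset.sum_apply, Pi.smul_apply, smul_eq_mul]
    fin_cases x
    · rw [Finset.sum_range_succ _ (N + 1)]
      simp only [Fin.zero_eta, Matrix.cons_val_zero, one_mul, Nat.not_succ_le_self, if_false,
        mul_zero, add_zero]
      refine Finset.sum_congr rfl fun n hn => ?_
      rw [if_pos (Nat.lt_succ_iff.1 (Finset.mem_range.1 hn))]
    · rw [Finset.sum_range_succ' _ (N + 1)]
      simp only [Fin.mk_one, Matrix.cons_val_one, Matrix.cons_val_fin_one, Finset.mul_sum,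
        Nat.add_sub_cancel, if_true, mul_zero, add_zero, Nat.succ_ne_zero, if_false]
      refine Finset.sum_congr rfl fun n _ => ?_
      rw [pow_succ]
      ring
  | @process N M M' _ _ ρ E hE h ih =>
    obtain ⟨ι, _, a, ha⟩ := ih
    obtain ⟨⟨r, K, hK⟩, -⟩ := hE
    refine ⟨ι × Fin r, inferInstance, fun i n => K i.2 *ᵥ a i.1 n, fun φ => ?_⟩
    simp only [hK, ha]
    rw [Fintype.sum_prod_type, Finset.sum_comm]
    refine Finset.sum_congr rfl fun j _ => ?_
    rw [Matrix.mul_sum, Matrix.sum_mul]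
    refine Finset.sum_congr rfl fun i _ => ?_
    rw [conj_ketbra, Matrix.mulVec_sum]
    simp only [Matrix.mulVec_smul]

theorem star_exp_mul_exp (φ : ℝ) :
    star (Complex.exp (φ * Complex.I)) * Complex.exp (φ * Complex.I) = 1 := by
  rw [RCLike.star_def, ← Complex.exp_conj, ← Complex.exp_add]
  simp

theorem U_conjTranspose_mul_self (φ : ℝ) : (U φ)ᴴ * U φ = 1 := by
  rw [U, Matrix.diagonal_conjTranspose, Matrix.diagonal_mul_diagonal, ← Matrix.diagonal_one]
  congr 1
  ext i
  fin_cases i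
  · simp
  · simpa using star_exp_mul_exp φ

/-- The `Fintype` instance is quantified after the colon because `StoredWith` hides the one used
inside; the two are identified in each case. -/
theorem StoredWith.trace_eq_one {N : ℕ} {M : Type} {ρ : ℝ → Matrix M M ℂ}
    (h : StoredWith N M ρ) : ∀ [Fintype M] (φ : ℝ), (ρ φ).trace = 1 := by
  induction h with
  | @prepare M inst ρ hρ =>
    intro inst' φ
    obtain rfl : inst = inst' := Subsingleton.elim _ _
    exact hρ.2
  | @use N A _ _ ρ h ih =>
    intro inst' φ
    obtain rfl : instFintypeProd (Fin 2) A = inst' := Subsingleton.elim _ _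
    rw [Matrix.trace_mul_comm, ← Matrix.mul_assoc, Matrix.conjTranspose_kronecker,
      ← Matrix.mul_kronecker_mul, U_conjTranspose_mul_self]
    simp [ih]
  | @process N M M' _ inst ρ E hE h ih =>
    intro inst' φ
    obtain rfl : inst = inst' := Subsingleton.elim _ _
    rw [hE.2, ih]

/-! ### Parseval's identity for trigonometric polynomials -/

/-- Orthogonality of characters over the `L`-th roots of unity: for `n ≠ m` this is a geometric sum
whose ratio differs from 1 because `n, m < L`. -/
theorem sum_pow_mul_star_pow {L : ℕ} (hL : L ≠ 0) {n m : ℕ} (hn : n < L) (hm : m < L) :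
    ∑ t ∈ Finset.range L, Complex.exp ((2 * Real.pi * t / L : ℝ) * Complex.I) ^ n *
      star (Complex.exp ((2 * Real.pi * t / L : ℝ) * Complex.I) ^ m) = if n = m then (L : ℂ) else 0 := by
  have hL' : (L : ℂ) ≠ 0 := Nat.cast_ne_zero.2 hL
  have hζ := Complex.isPrimitiveRoot_exp L hL
  set ζ := Complex.exp (2 * Real.pi * Complex.I / L) with hζdef
  have h1 : ∀ t : ℕ, Complex.exp ((2 * Real.pi * t / L : ℝ) * Complex.I) = ζ ^ t := by
    intro t
    rw [hζdef, ← Complex.exp_nat_mul]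
    congr 1
    push_cast
    ring
  have hu : star ζ * ζ = 1 := by
    rw [← pow_one ζ, ← h1 1]
    exact star_exp_mul_exp _
  have h2 : ∀ t : ℕ, (ζ ^ t) ^ n * star ((ζ ^ t) ^ m) = (ζ ^ n * star ζ ^ m) ^ t := by
    intro t
    rw [star_pow, star_pow, mul_pow, ← pow_mul, ← pow_mul, ← pow_mul, ← pow_mul, mul_comm t,
      mul_comm t]
  simp only [h1, h2]
  split_ifs with hnm
  · subst hnm
    rw [← mul_pow, mul_comm ζ, hu]
    simp
  · have hw : ζ ^ n * star ζ ^ m ≠ 1 := by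
      intro h
      apply hnm
      apply hζ.pow_inj hn hm
      calc ζ ^ n = ζ ^ n * (star ζ * ζ) ^ m := by rw [hu, one_pow, mul_one]
        _ = ζ ^ n * star ζ ^ m * ζ ^ m := by rw [mul_pow, mul_assoc]
        _ = ζ ^ m := by rw [h, one_mul]
    have hp : (ζ ^ n * star ζ ^ m) ^ L = 1 := by
      rw [mul_pow, ← pow_mul, ← pow_mul, mul_comm n, mul_comm m, pow_mul, pow_mul, ← star_pow,
        hζ.pow_eq_one]
      simp
    have := mul_geom_sum (ζ ^ n * star ζ ^ m) L
    rw [hp, sub_self] at this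
    exact (mul_eq_zero.1 this).resolve_left (sub_ne_zero.2 hw)

theorem sum_normSq_trigPoly {L : ℕ} (hL : L ≠ 0) (c : ℕ → ℂ) :
    ∑ t ∈ Finset.range L, Complex.normSq (∑ n ∈ Finset.range L,
      Complex.exp ((2 * Real.pi * t / L : ℝ) * Complex.I) ^ n * c n) =
      L * ∑ n ∈ Finset.range L, Complex.normSq (c n) := by
  apply Complex.ofReal_injective
  push_cast [Complex.normSq_eq_conj_mul_self]
  rw [Finset.mul_sum]
  calc _ = ∑ t ∈ Finset.range L, ∑ m ∈ Finset.range L, ∑ n ∈ Finset.range L,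
        (Complex.exp ((2 * Real.pi * t / L : ℝ) * Complex.I) ^ n *
          star (Complex.exp ((2 * Real.pi * t / L : ℝ) * Complex.I) ^ m)) *
          (star (c m) * c n) := by
        refine Finset.sum_congr rfl fun t _ => ?_
        rw [map_sum, Finset.sum_mul]
        refine Finset.sum_congr rfl fun m _ => ?_
        rw [Finset.mul_sum]
        refine Finset.sum_congr rfl fun n _ => ?_
        simp only [RCLike.star_def, map_mul]
        push_cast
        ring
    _ = ∑ m ∈ Finset.range L, ∑ n ∈ Finset.range L, (if n = m then (L : ℂ) else 0) *
          (star (c m) * c n) := by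
        rw [Finset.sum_comm]
        refine Finset.sum_congr rfl fun m hm => ?_
        rw [Finset.sum_comm]
        refine Finset.sum_congr rfl fun n hn => ?_
        rw [← Finset.sum_mul, sum_pow_mul_star_pow hL (Finset.mem_range.1 hn)
          (Finset.mem_range.1 hm)]
    _ = _ := by
        refine Finset.sum_congr rfl fun m hm => ?_
        simp only [ite_mul, zero_mul, Finset.sum_ite_eq', hm, if_true]
        rfl

/-- Since the sum is constant in `φ`, averaging over `L` equidistant angles replaces an integral. It
serves for the norm of the program, for the success probability and, with `p = 0`, for uniqueness of
coefficients. -/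
theorem sum_normSq_coeff_eq {L : ℕ} (hL : L ≠ 0) {κ : Type} [Fintype κ] (c : κ → ℕ → ℂ) (p : ℝ)
    (h : ∀ φ : ℝ, ∑ i, Complex.normSq (∑ n ∈ Finset.range L,
      Complex.exp (φ * Complex.I) ^ n * c i n) = p) :
    ∑ n ∈ Finset.range L, ∑ i, Complex.normSq (c i n) = p := by
  have hL' : (L : ℝ) ≠ 0 := Nat.cast_ne_zero.2 hL
  rw [Finset.sum_comm]
  apply mul_left_cancel₀ hL'
  rw [Finset.mul_sum]
  simp only [← sum_normSq_trigPoly hL]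
  rw [Finset.sum_comm]
  simp only [h, Finset.sum_const, Finset.card_range, nsmul_eq_mul]

theorem coeff_shift {N : ℕ} {c d : ℕ → ℂ}
    (h : ∀ φ : ℝ, ∑ n ∈ Finset.range (N + 1), Complex.exp (φ * Complex.I) ^ n * d n =
      Complex.exp (φ * Complex.I) *
        ∑ n ∈ Finset.range (N + 1), Complex.exp (φ * Complex.I) ^ n * c n) :
    (∀ n < N, d (n + 1) = c n) ∧ c N = 0 := by
  -- The coefficients of `D(z) - z C(z)`, of degree at most `N + 1`; the top one is `-c N`.
  set e : ℕ → ℂ := fun n => (if n ≤ N then d n else 0) - if n = 0 then 0 else c (n - 1) with he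
  have h1 : ∀ φ : ℝ, ∑ n ∈ Finset.range (N + 2), Complex.exp (φ * Complex.I) ^ n * e n = 0 := by
    intro φ
    simp only [he, mul_sub, Finset.sum_sub_distrib]
    rw [sub_eq_zero, Finset.sum_range_succ, Finset.sum_range_succ' _ (N + 1)]
    simp only [Nat.not_succ_le_self, if_false, mul_zero, add_zero, if_true, Nat.succ_ne_zero,
      Nat.add_sub_cancel]
    calc _ = ∑ n ∈ Finset.range (N + 1), Complex.exp (φ * Complex.I) ^ n * d n :=
          Finset.sum_congr rfl fun n hn => by
            rw [if_pos (Nat.lt_succ_iff.1 (Finset.mem_range.1 hn))]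
      _ = _ := by
          rw [h, Finset.mul_sum]
          refine Finset.sum_congr rfl fun n _ => ?_
          rw [pow_succ]
          ring
  have h2 := sum_normSq_coeff_eq (L := N + 2) (by omega) (κ := Unit) (fun _ => e) 0 (by simp [h1])
  rw [Finset.sum_eq_zero_iff_of_nonneg
    (fun n _ => Finset.sum_nonneg fun i _ => Complex.normSq_nonneg _)] at h2
  have h3 : ∀ n < N + 2, e n = 0 := fun n hn => by simpa using h2 n (Finset.mem_range.2 hn)
  refine ⟨fun n hn => ?_, ?_⟩
  · have := h3 (n + 1) (by omega)
    simpa [he, Nat.succ_le_of_lt hn, sub_eq_zero] using this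
  · simpa [he] using h3 (N + 1) (by omega)

/-! ### Perfect retrieval -/

/-- The component `b` of the output of `K` on input `|x⟩ ⊗ ψ`. -/
def amp {M : Type} [Fintype M] (K : Matrix (Fin 2) (Fin 2 × M) ℂ) (x b : Fin 2) (ψ : M → ℂ) : ℂ :=
  ∑ m, K b (x, m) * ψ m

theorem amp_sum {M : Type} [Fintype M] (K : Matrix (Fin 2) (Fin 2 × M) ℂ) (x b : Fin 2)
    (s : Finset ℕ) (z : ℂ) (a : ℕ → M → ℂ) :
    amp K x b (∑ n ∈ s, z ^ n • a n) = ∑ n ∈ s, z ^ n * amp K x b (a n) := by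
  simp only [amp, Finset.sum_apply, Pi.smul_apply, smul_eq_mul, Finset.mul_sum]
  rw [Finset.sum_comm]
  refine Finset.sum_congr rfl fun n _ => Finset.sum_congr rfl fun m _ => ?_
  ring

theorem conj_kronecker_ketbra {M : Type} [Fintype M] (K : Matrix (Fin 2) (Fin 2 × M) ℂ)
    (ξ : Matrix (Fin 2) (Fin 2) ℂ) (ψ : M → ℂ) (b b' : Fin 2) :
    (K * (ξ ⊗ₖ ketbra ψ) * Kᴴ) b b' =
      ∑ x, ∑ x', ξ x x' * (amp K x b ψ * star (amp K x' b' ψ)) := by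
  simp only [Matrix.mul_apply, Fintype.sum_prod_type, Matrix.kroneckerMap_apply, ketbra,
    vecMulVec_apply, Matrix.conjTranspose_apply, Pi.star_apply]
  have h1 : ∀ x' m', ∑ x, ∑ m, K b (x, m) * (ξ x x' * (ψ m * star (ψ m'))) =
      (∑ x, ξ x x' * amp K x b ψ) * star (ψ m') := by
    intro x' m'
    rw [Finset.sum_mul]
    refine Finset.sum_congr rfl fun x _ => ?_
    rw [amp, Finset.mul_sum, Finset.sum_mul]
    refine Finset.sum_congr rfl fun m _ => ?_
    ring
  rw [Finset.sum_comm (f := fun x x' => ξ x x' * (amp K x b ψ * star (amp K x' b' ψ)))]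
  refine Finset.sum_congr rfl fun x' _ => ?_
  simp only [h1]
  simp only [← mul_assoc (ξ _ _)]
  rw [← Finset.sum_mul, amp, star_sum, Finset.mul_sum]
  refine Finset.sum_congr rfl fun m _ => ?_
  rw [star_mul']
  ring

theorem isState_ketbra {a : Type} [Fintype a] {ψ : a → ℂ} (h : ∑ x, ψ x * star (ψ x) = 1) :
    IsState (ketbra ψ) :=
  ⟨Matrix.posSemidef_vecMulVec_self_star ψ, by simpa [Matrix.trace, ketbra, vecMulVec_apply] using h⟩

theorem sum_mul_star_eq_normSq {κ : Type} [Fintype κ] (c : κ → ℂ) :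
    ∑ k, c k * star (c k) = ((∑ k, Complex.normSq (c k) : ℝ) : ℂ) := by
  push_cast [← Complex.mul_conj]
  rfl

theorem eq_zero_of_sum_mul_star {κ : Type} [Fintype κ] {c : κ → ℂ}
    (h : ∑ k, c k * star (c k) = 0) (k : κ) : c k = 0 := by
  rw [sum_mul_star_eq_normSq, Complex.ofReal_eq_zero,
    Finset.sum_eq_zero_iff_of_nonneg fun n _ => Complex.normSq_nonneg _] at h
  simpa using h k (Finset.mem_univ k)

/-- The equality case of Cauchy–Schwarz: basis inputs fix the norms of the families `A · 0 0` and `A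
· 1 1` and kill the bit-flip amplitudes, while one superposed input fixes their inner product. -/
theorem amplitudes_of_perfect {κ : Type} [Fintype κ] (A : κ → Fin 2 → Fin 2 → ℂ) (φ p : ℝ)
    (h : ∀ ξ : Matrix (Fin 2) (Fin 2) ℂ, IsState ξ → ∀ b b',
      ∑ k, ∑ x, ∑ x', ξ x x' * (A k x b * star (A k x' b')) =
        ((p : ℂ) • (U φ * ξ * (U φ)ᴴ)) b b') :
    (∀ k, A k 1 1 = Complex.exp (φ * Complex.I) * A k 0 0) ∧
      ∑ k, Complex.normSq (A k 0 0) = p := by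
  have hz := star_exp_mul_exp φ
  have hU : ∀ ξ : Matrix (Fin 2) (Fin 2) ℂ, ∀ b b', ((p : ℂ) • (U φ * ξ * (U φ)ᴴ)) b b' =
      p * (![1, Complex.exp (φ * Complex.I)] b * ξ b b' *
        star (![1, Complex.exp (φ * Complex.I)] b')) := by
    intro ξ b b'
    rw [U, Matrix.diagonal_conjTranspose, Matrix.smul_apply, Matrix.mul_diagonal,
      Matrix.diagonal_mul]
    rfl
  simp only [hU] at h
  generalize Complex.exp (φ * Complex.I) = z at *
  have s0 : IsState (ketbra ![1, 0]) := isState_ketbra (by simp)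
  have s1 : IsState (ketbra ![0, 1]) := isState_ketbra (by simp)
  -- Any superposition with both amplitudes nonzero would do; the Pythagorean triple keeps the
  -- normalization rational.
  have s2 : IsState (ketbra ![3 / 5, 4 / 5]) :=
    isState_ketbra (by simp [Complex.conj_ofNat]; norm_num)
  have h00 := h _ s0 0 0
  have h01 := h _ s0 1 1
  have h10 := h _ s1 0 0
  have h11 := h _ s1 1 1
  have h2 := h _ s2 0 1
  simp only [ketbra, vecMulVec_apply, Fin.sum_univ_two, Pi.star_apply, Matrix.cons_val_zero,
    Matrix.cons_val_one, Matrix.cons_val_fin_one, star_one, star_zero, mul_zero, zero_mul, mul_one,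
    one_mul, add_zero, zero_add] at h00 h01 h10 h11 h2
  have z01 := eq_zero_of_sum_mul_star h01
  have z10 := eq_zero_of_sum_mul_star h10
  have h3 : ∑ k, A k 0 0 * star (A k 1 1) = p * star z := by
    have h5 : (3 / 5 * star (4 / 5) : ℂ) ≠ 0 := by simp
    apply mul_left_cancel₀ h5
    simp only [z01, z10, star_zero, mul_zero, zero_mul, zero_add, add_zero] at h2
    rw [Finset.mul_sum, h2]
    ring
  have h4 : ∑ k, A k 1 1 * star (A k 0 0) = p * z := by
    have := congrArg star h3
    simp only [star_sum, star_mul', star_star] at this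
    rw [Finset.sum_congr rfl fun k _ => mul_comm (A k 1 1) _, this]
    simp
  refine ⟨fun k => ?_, ?_⟩
  · refine sub_eq_zero.1 (eq_zero_of_sum_mul_star (c := fun k => A k 1 1 - z * A k 0 0) ?_ k)
    -- Summed over `k`, the four terms become `p z z̄` with signs `+, -, -, +`, so all the
    -- differences vanish.
    have h5 : ∀ k, (A k 1 1 - z * A k 0 0) * star (A k 1 1 - z * A k 0 0) =
        A k 1 1 * star (A k 1 1) - z * (A k 0 0 * star (A k 1 1)) -
          star z * (A k 1 1 * star (A k 0 0)) + z * star z * (A k 0 0 * star (A k 0 0)) := by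
      intro k
      rw [star_sub, star_mul']
      ring
    simp only [h5, Finset.sum_add_distrib, Finset.sum_sub_distrib, ← Finset.mul_sum, h00, h11, h3,
      h4]
    ring
  · rw [sum_mul_star_eq_normSq] at h00
    exact Complex.ofReal_injective h00

/-- Trace preservation on `|x⟩⟨x| ⊗ |ψ⟩⟨ψ|` makes the squared amplitudes over both operations and
all outputs add up to `‖ψ‖²`. No normalization of `ψ` is assumed, so it applies to single
coefficient vectors. -/
theorem instrument_contraction {M : Type} [Fintype M] {r : ℕ}
    {Rs Rf : Matrix (Fin 2 × M) (Fin 2 × M) ℂ → Matrix (Fin 2) (Fin 2) ℂ}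
    (h : IsInstrument Rs Rf) {K : Fin r → Matrix (Fin 2) (Fin 2 × M) ℂ}
    (hK : ∀ X, Rs X = ∑ i, K i * X * (K i)ᴴ) (x b : Fin 2) (ψ : M → ℂ) :
    ∑ j, Complex.normSq (amp (K j) x b ψ) ≤ ∑ m, Complex.normSq (ψ m) := by
  obtain ⟨-, ⟨s, L, hL⟩, htr⟩ := h
  have h1 := htr (Matrix.single x x 1 ⊗ₖ ketbra ψ)
  have key : ∀ {r : ℕ} (K : Fin r → Matrix (Fin 2) (Fin 2 × M) ℂ),
      (∑ i, K i * (Matrix.single x x 1 ⊗ₖ ketbra ψ) * (K i)ᴴ).trace =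
        ((∑ b, ∑ j, Complex.normSq (amp (K j) x b ψ) : ℝ) : ℂ) := by
    intro r K
    simp only [Matrix.trace, Matrix.diag_apply, Matrix.sum_apply, conj_kronecker_ketbra]
    rw [Complex.ofReal_sum]
    refine Finset.sum_congr rfl fun b _ => ?_
    rw [← sum_mul_star_eq_normSq]
    refine Finset.sum_congr rfl fun j _ => ?_
    fin_cases x <;> simp [Matrix.single_apply]
  have hψ : (Matrix.single x x 1 ⊗ₖ ketbra ψ).trace = ((∑ m, Complex.normSq (ψ m) : ℝ) : ℂ) := by
    rw [Matrix.trace_kronecker, Matrix.trace_single_eq_same, one_mul, ← sum_mul_star_eq_normSq]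
    rfl
  rw [Matrix.trace_add, hK, hL, key, key, hψ, ← Complex.ofReal_add, Complex.ofReal_inj] at h1
  have h2 : 0 ≤ ∑ b, ∑ j, Complex.normSq (amp (L j) x b ψ) :=
    Finset.sum_nonneg fun _ _ => Finset.sum_nonneg fun _ _ => Complex.normSq_nonneg _
  have h3 := Finset.single_le_sum (f := fun b => ∑ j, Complex.normSq (amp (K j) x b ψ))
    (fun _ _ => Finset.sum_nonneg fun _ _ => Complex.normSq_nonneg _) (Finset.mem_univ b)
  linarith

/-- Split `N + 1 = (N - n) + (n + 1)`, using the first bound with weight `N - n` and the second with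
weight `n + 1`. After reindexing, each `q n` has total weight `(N - n) + n = N`. -/
theorem sum_le_of_le_neighbours (N : ℕ) (s q : ℕ → ℝ) (h0 : ∀ n < N, s n ≤ q n)
    (h1 : ∀ n < N, s n ≤ q (n + 1)) (hN : s N = 0) (hq : ∑ n ∈ Finset.range (N + 1), q n = 1) :
    ∑ n ∈ Finset.range (N + 1), s n ≤ 1 - 1 / (N + 1) := by
  have hpos : (0 : ℝ) < N + 1 := by positivity
  have h2 : (N + 1) * ∑ n ∈ Finset.range (N + 1), s n ≤ N := by
    rw [Finset.sum_range_succ, hN, add_zero, Finset.mul_sum]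
    calc ∑ n ∈ Finset.range N, (N + 1) * s n
        ≤ ∑ n ∈ Finset.range N, ((N - n) * q n + (n + 1 : ℕ) * q (n + 1)) := by
          refine Finset.sum_le_sum fun n hn => ?_
          have hn := Finset.mem_range.1 hn
          have hn' : (n : ℝ) ≤ N := by exact_mod_cast hn.le
          have a := mul_le_mul_of_nonneg_left (h0 n hn) (sub_nonneg.2 hn')
          have b := mul_le_mul_of_nonneg_left (h1 n hn) (Nat.cast_nonneg (α := ℝ) (n + 1))
          push_cast at b ⊢
          linarith
      _ = ∑ n ∈ Finset.range (N + 1), (N - n) * q n + ∑ n ∈ Finset.range (N + 1), n * q n := by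
          rw [Finset.sum_add_distrib, Finset.sum_range_succ, Finset.sum_range_succ' _ N]
          simp
      _ = N * ∑ n ∈ Finset.range (N + 1), q n := by
          rw [← Finset.sum_add_distrib, Finset.mul_sum]
          refine Finset.sum_congr rfl fun n _ => ?_
          ring
      _ = N := by rw [hq, mul_one]
  rw [one_sub_div hpos.ne', le_div_iff₀ hpos]
  linarith

theorem psrProbs_le {N : ℕ} {p : ℝ} (hp : p ∈ psrProbs N) : p ≤ 1 - 1 / (N + 1) := by
  obtain ⟨M, _, ρ, hρ, Rs, Rf, hR, hperf⟩ := hp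
  obtain ⟨ι, _, a, ha⟩ := hρ.exists_expansion
  obtain ⟨r, K, hK⟩ := hR.1
  have hq : ∑ n ∈ Finset.range (N + 1), ∑ k : ι × M, Complex.normSq (a k.1 n k.2) = 1 := by
    refine sum_normSq_coeff_eq N.succ_ne_zero (fun (k : ι × M) n => a k.1 n k.2) 1 fun φ => ?_
    have := hρ.trace_eq_one φ
    rw [ha, Matrix.trace_sum] at this
    rw [← Complex.ofReal_inj, ← sum_mul_star_eq_normSq, Complex.ofReal_one, ← this,
      Fintype.sum_prod_type]
    simp [Matrix.trace, ketbra, vecMulVec_apply]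
  -- The amplitudes are indexed by a pure term of the program together with a Kraus operator of the
  -- success operation.
  have hA := fun φ : ℝ => amplitudes_of_perfect (κ := ι × Fin r) (fun k x b => amp (K k.2) x b
      (∑ n ∈ Finset.range (N + 1), Complex.exp (φ * Complex.I) ^ n • a k.1 n)) φ p (by
    intro ξ hξ b b'
    rw [← hperf φ ξ hξ, hK, ha, Fintype.sum_prod_type, Finset.sum_comm, Matrix.sum_apply]
    refine Finset.sum_congr rfl fun j _ => ?_
    have : ξ ⊗ₖ (∑ i, ketbra (∑ n ∈ Finset.range (N + 1),
        Complex.exp (φ * Complex.I) ^ n • a i n)) = ∑ i, ξ ⊗ₖ ketbra (∑ n ∈ Finset.range (N + 1),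
        Complex.exp (φ * Complex.I) ^ n • a i n) := by
      ext x y
      simp [Matrix.sum_apply, Finset.mul_sum]
    rw [this, Matrix.mul_sum, Matrix.sum_mul, Matrix.sum_apply]
    refine Finset.sum_congr rfl fun i _ => ?_
    rw [conj_kronecker_ketbra])
  simp only [amp_sum] at hA
  have hshift := fun k : ι × Fin r => coeff_shift fun φ => (hA φ).1 k
  have hs := sum_normSq_coeff_eq N.succ_ne_zero (fun (k : ι × Fin r) n => amp (K k.2) 0 0 (a k.1 n))
    p fun φ => (hA φ).2
  have hcon : ∀ x n, ∑ k : ι × Fin r, Complex.normSq (amp (K k.2) x x (a k.1 n)) ≤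
      ∑ k : ι × M, Complex.normSq (a k.1 n k.2) := by
    intro x n
    rw [Fintype.sum_prod_type, Fintype.sum_prod_type]
    exact Finset.sum_le_sum fun i _ => instrument_contraction hR hK x x (a i n)
  rw [← hs]
  refine sum_le_of_le_neighbours N _ _ (fun n _ => hcon 0 n) (fun n hn => ?_) ?_ hq
  · refine le_trans (le_of_eq ?_) (hcon 1 (n + 1))
    exact Finset.sum_congr rfl fun k _ => by rw [(hshift k).1 n hn]
  · exact Finset.sum_eq_zero fun k _ => by rw [(hshift k).2, map_zero]

/-! ### The storing network -/

theorem onQubit_mulVec_apply {n : ℕ} (q : Fin n) (d : Fin 2 → ℂ) (ψ : (Fin n → Fin 2) → ℂ)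
    (x : Fin n → Fin 2) : (onQubit q (diagonal d) *ᵥ ψ) x = d (x q) * ψ x := by
  have h : onQubit q (diagonal d) = diagonal fun x => d (x q) := by
    ext x y
    simp only [onQubit, Matrix.of_apply, Matrix.diagonal_apply]
    by_cases hxy : x = y
    · subst hxy
      simp
    · rw [if_neg hxy]
      split_ifs with h1 h2
      · refine absurd (funext fun r => ?_) hxy
        by_cases hr : r = q
        · rw [hr, h2]
        · exact h1 r hr
      · rfl
      · rfl
  rw [h, Matrix.mulVec_diagonal]

theorem applyUses_apply {k : ℕ} (φ : ℝ) (l : List (Fin k)) (ψ : (Fin k → Fin 2) → ℂ)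
    (x : Fin k → Fin 2) : applyUses φ l ψ x =
      (l.map fun q => ![1, Complex.exp (φ * Complex.I)] (x q)).prod * ψ x := by
  induction l generalizing ψ with
  | nil => simp [applyUses]
  | cons q l ih =>
    have : applyUses φ (q :: l) ψ = applyUses φ l (onQubit q (U φ) *ᵥ ψ) := rfl
    rw [this, ih, U, onQubit_mulVec_apply, List.map_cons, List.prod_cons]
    ring

theorem applyUses_vmcUses (k : ℕ) (φ : ℝ) :
    applyUses φ (vmcUses k) (plusState k) = vmcProgram k φ := by
  ext x
  rw [applyUses_apply, vmcUses, List.map_flatMap, List.flatMap_def, List.prod_flatten,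
    List.map_map]
  simp only [Function.comp_def, List.map_replicate, List.prod_replicate]
  rw [← List.ofFn_eq_map, List.prod_ofFn, plusState, vmcProgram, ← Finset.prod_mul_distrib]
  refine Finset.prod_congr rfl fun m _ => ?_
  rw [phaseKet]
  generalize x m = b
  fin_cases b
  · simp
  · simp [← Complex.exp_nat_mul]
    rw [mul_comm]
    congr 2
    ring

theorem length_vmcUses (k : ℕ) : (vmcUses k).length = 2 ^ k - 1 := by
  rw [vmcUses, List.length_flatMap]
  simp only [List.length_replicate]
  rw [← List.ofFn_eq_map, List.sum_ofFn, Fin.sum_univ_eq_sum_range (fun i => 2 ^ i),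
    Nat.geomSum_eq le_rfl]
  simp

theorem isChannel_submatrix {a b : Type} [Fintype a] [Fintype b] [DecidableEq a] (e : b ≃ a) :
    IsChannel (fun X : Matrix a a ℂ => X.submatrix e e) :=
  ⟨isCP_submatrix e, fun X => e.sum_comp fun i => X i i⟩

/-- The network model acts on the first factor of `Fin 2 × A`, so qubit `q` is split off from the
register and afterwards put back; both relabellings are channels. -/
theorem StoredWith.onQubit {N k : ℕ} (q : Fin k) {ψ : ℝ → (Fin k → Fin 2) → ℂ}
    (h : StoredWith N (Fin k → Fin 2) fun φ => ketbra (ψ φ)) :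
    StoredWith (N + 1) (Fin k → Fin 2)
      fun φ => ketbra (PhaseStorage.onQubit q (U φ) *ᵥ ψ φ) := by
  let e := Equiv.funSplitAt q (Fin 2)
  have h1 := ((h.process _ (isChannel_submatrix e.symm)).use).process _ (isChannel_submatrix e)
  convert h1 using 1
  funext φ
  have h2 : (ketbra (ψ φ)).submatrix e.symm e.symm = ketbra (ψ φ ∘ e.symm) := rfl
  rw [h2, conj_ketbra]
  have h3 : ∀ v : _ → ℂ, (ketbra v).submatrix e e = ketbra (v ∘ e) := fun _ => rfl
  rw [h3]
  congr 1
  ext x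
  rw [Function.comp_apply, U_mul_apply, U, onQubit_mulVec_apply]
  rw [Function.comp_apply, Equiv.symm_apply_apply]
  rfl

theorem StoredWith.applyUses {N k : ℕ} (l : List (Fin k)) {ψ : ℝ → (Fin k → Fin 2) → ℂ}
    (h : StoredWith N (Fin k → Fin 2) fun φ => ketbra (ψ φ)) :
    StoredWith (N + l.length) (Fin k → Fin 2)
      fun φ => ketbra (PhaseStorage.applyUses φ l (ψ φ)) := by
  induction l generalizing N ψ with
  | nil => exact h
  | cons q l ih =>
    rw [List.length_cons, add_comm l.length, ← add_assoc]
    exact ih (h.onQubit q)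

theorem isState_plusState (k : ℕ) : IsState (ketbra (plusState k)) := by
  have h2 : (((Real.sqrt 2 : ℝ) : ℂ))⁻¹ * (((Real.sqrt 2 : ℝ) : ℂ))⁻¹ = 1 / 2 := by
    rw [← mul_inv, ← Complex.ofReal_mul, Real.mul_self_sqrt (by norm_num)]
    norm_num
  apply isState_ketbra
  have h : ∀ x : Fin k → Fin 2, plusState k x = ((Real.sqrt 2 : ℝ) : ℂ)⁻¹ ^ k := by
    intro x
    have : ∀ b : Fin 2, ![(1 : ℂ), 1] b = 1 := by
      intro b
      fin_cases b <;> rfl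
    simp [plusState, this]
  simp only [h, star_pow, RCLike.star_def, map_inv₀, Complex.conj_ofReal, ← mul_pow, h2]
  simp

theorem storedWith_vmcProgram (k : ℕ) :
    StoredWith (2 ^ k - 1) (Fin k → Fin 2) fun φ => ketbra (vmcProgram k φ) := by
  have h := (StoredWith.prepare _ (isState_plusState k)).applyUses (vmcUses k)
  simpa only [zero_add, length_vmcUses, applyUses_vmcUses] using h

end PhaseStorage

open PhaseStorage
theorem mainTheorem2 (k : ℕ) :
    -- the program state is prepared with `2^k - 1` uses of the gate
    ((vmcUses k).length = 2 ^ k - 1 ∧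
      (∀ φ : ℝ, applyUses φ (vmcUses k) (plusState k) = vmcProgram k φ) ∧
      StoredWith (2 ^ k - 1) (Fin k → Fin 2) (fun φ => ketbra (vmcProgram k φ))) ∧
    -- the retrieving circuit has `k` CNOT gates and `k` one-qubit measurements
    ((vmcRetrieval k).cnotCount = k ∧ (vmcRetrieval k).measurementCount = k) ∧
    -- it is an instrument that retrieves the gate perfectly with probability `1 - 2^(-k)`
    (IsInstrument ((vmcRetrieval k).operation true) ((vmcRetrieval k).operation false) ∧
      RetrievesPerfectly ((vmcRetrieval k).operation true)
        (fun φ => ketbra (vmcProgram k φ)) (1 - 1 / 2 ^ k)) ∧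
    -- this is the optimal probability of storage and retrieval with `2^k - 1` uses
    IsGreatest (psrProbs (2 ^ k - 1)) (1 - 1 / 2 ^ k) ∧
    -- hence the program state is optimal, and the scheme is the best way to retrieve from it
    IsOptimalProgram (2 ^ k - 1) (fun φ => ketbra (vmcProgram k φ)) ∧
    IsGreatest (retrievalProbs (fun φ => ketbra (vmcProgram k φ))) (1 - 1 / 2 ^ k) := by
  have hret : (1 - 1 / 2 ^ k : ℝ) ∈ retrievalProbs fun φ => ketbra (vmcProgram k φ) :=
    ⟨_, _, Circuit.isInstrument_operation _, retrievesPerfectly_vmcRetrieval k⟩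
  have hst := storedWith_vmcProgram k
  have hle : ∀ p ∈ psrProbs (2 ^ k - 1), p ≤ 1 - 1 / 2 ^ k := by
    intro p hp
    have h := psrProbs_le hp
    -- Needed to cast the truncated subtraction `2 ^ k - 1`, after which `N + 1` becomes `2 ^ k`.
    have h2 : 1 ≤ 2 ^ k := Nat.one_le_two_pow
    push_cast [h2] at h
    rwa [sub_add_cancel] at h
  have hgr : IsGreatest (psrProbs (2 ^ k - 1)) (1 - 1 / 2 ^ k) :=
    ⟨⟨_, inferInstance, _, hst, hret⟩, hle⟩
  exact ⟨⟨length_vmcUses k, applyUses_vmcUses k, hst⟩,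
    ⟨by rw [vmcRetrieval, cnotCount_vmcSteps, List.length_finRange],
      by rw [vmcRetrieval, measurementCount_vmcSteps, List.length_finRange]⟩,
    ⟨Circuit.isInstrument_operation _, retrievesPerfectly_vmcRetrieval k⟩, hgr,
    -- Any retrieval from this program is itself a `(2^k - 1) → 1` protocol, so the general bound
    -- applies to it.
    ⟨hst, _, hret, hgr⟩, hret, fun p hp => hle p ⟨_, inferInstance, _, hst, hp⟩⟩
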